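/- Let $d\in\mathbb{N}$, $\hbar>0$, and let $J=\begin{bmatrix}0&I_d\\-I_d&0\end{bmatrix}$. On the Schwartz space $\mathscr{S}(\mathbb{R}^d)\subset L^2(\mathbb{R}^d)$ let $\hat x_jf=x_jf$ and $\hat p_jf=-\mathrm{i}\hbar\,\partial_{x_j}f$, let $\hat z=(\hat x,\hat p)$, and let $$\hat a_j=\tfrac{1}{\sqrt{2\hbar}}(\hat x_j+\mathrm{i}\hat p_j),\qquad \hat a_j^*=\tfrac{1}{\sqrt{2\hbar}}(\hat x_j-\mathrm{i}\hat p_j)$$ be the ladder operators of the harmonic oscillator. For $z=(q,p)\in\mathbb{R}^{2d}$ let $\widehat T_z$ be the Heisenberg--Weyl operator, i.e. the unitary operator $(\widehat T_zf)(x)=e^{\frac{\mathrm i}{\hbar}p\cdot(x-q/2)}f(x-q)$ of $L^2(\mathbb{R}^d)$. The metaplectic group $\mathsf{Mp}(2d,\mathbb{R})$ is the group of unitary operators of $L^2(\mathbb{R}^d)$ generated by $$\widehat J\psi(x)=\tfrac{1}{(2\pi\hbar\mathrm i)^{d/2}}\int_{\mathbb{R}^d} e^{-\frac{\mathrm i}{\hbar}x\cdot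 y}\psi(y)\,dy,\qquad \widehat V_R\psi(x)=e^{\frac{\mathrm i}{2\hbar}x^TRx}\psi(x),\qquad \widehat M^m_L\psi(x)=\mathrm i^m\sqrt{|\det L|}\,\psi(Lx),$$ where $R$ runs through the real symmetric $d\times d$ matrices, $L$ through $\mathsf{GL}(d,\mathbb{R})$, and $m\in\mathbb{Z}$ satisfies $m\pi\equiv\arg(\det L)\pmod{2\pi}$. The projection $\pi_{\mathsf{Mp}}\colon\mathsf{Mp}(2d,\mathbb{R})\to\mathsf{Sp}(2d,\mathbb{R})$ is the homomorphism with $$\widehat J\mapsto J,\qquad \widehat V_R\mapsto\begin{bmatrix}I&0\\R&I\end{bmatrix},\qquad \widehat M_L^m\mapsto\begin{bmatrix}L^{-1}&0\\0&L^T\end{bmatrix}.$$ For $S\in\mathsf{Sp}(2d,\mathbb{R})$ and $z=(q,p)\in\mathbb{R}^{2d}$, the Hagedorn ladder operators $\mathscr{A}_j(S,z)$ (lowering) and $\mathscr{A}^*_j(S,z)$ (raising), $1\le j\le d$, are the first $d$ and the last $d$ components of $$\rho(SW_\hbar;\hat z-z):=(SW_\hbar)^TJ(\hat z-z),\qquad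 W_\hbar=\tfrac{1}{\sqrt{2\hbar}}\begin{bmatrix}\mathrm iI_d&-\mathrm iI_d\\-I_d&-I_d\end{bmatrix},$$ regarded as operators on $L^2(\mathbb{R}^d)$ with domain $\mathscr{S}(\mathbb{R}^d)$. Let $\widehat S\in\mathsf{Mp}(2d,\mathbb{R})$ be any metaplectic operator with $\pi_{\mathsf{Mp}}(\widehat S)=S$. Then: 1. For each $j$, as operators on $L^2(\mathbb{R}^d)$ with domain $\mathscr{S}(\mathbb{R}^d)$ (equality of domains included), $$\mathscr{A}_j(S,z)=\widehat T_z\,\widehat S\,\hat a_j\,\widehat S^*\,\widehat T_z^*,\qquad \mathscr{A}^*_j(S,z)=\widehat T_z\,\widehat S\,\hat a^*_j\,\widehat S^*\,\widehat T_z^*.$$ 2. The operator $\widehat T_z\widehat S$ restricts to a linear bijection of $\mathscr{S}(\mathbb{R}^d)$ onto itself, and for each $j$, on $\mathscr{S}(\mathbb{R}^d)$, $$\mathscr{A}_j(S,z)\,\widehat T_z\widehat S=\widehat T_z\widehat S\,\hat a_j,\qquad \mathscr{A}_j^*(S,z)\,\widehat T_z\widehat S=\widehat T_z\widehat S\,\hat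 a_j^*.$$ 3. If $S=\begin{bmatrix}\operatorname{Re}Q&\operatorname{Im}Q\\\operatorname{Re}P&\operatorname{Im}P\end{bmatrix}$ with $Q,P\in\mathsf{M}_d(\mathbb{C})$, then $$\mathscr{A}(S,z)=-\tfrac{\mathrm i}{\sqrt{2\hbar}}\bigl[P^T(\hat x-q)-Q^T(\hat p-p)\bigr],\qquad \mathscr{A}^*(S,z)=\tfrac{\mathrm i}{\sqrt{2\hbar}}\bigl[P^*(\hat x-q)-Q^*(\hat p-p)\bigr],$$ where $P^*,Q^*$ are the conjugate transposes. 4. For each $j$, the Hilbert-space adjoint of $\mathscr{A}_j(S,z)$ extends $\mathscr{A}_j^*(S,z)$. -/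

import Mathlib

open MeasureTheory Complex
open scoped SchwartzMap FourierTransform LineDeriv Matrix

noncomputable section

namespace Hagedorn

/-- Configuration space `ℝ^d` with its Euclidean structure. -/
abbrev Conf (d : ℕ) : Type := EuclideanSpace ℝ (Fin d)

/-- The Hilbert space `L²(ℝ^d)` of complex-valued functions. -/
abbrev L2 (d : ℕ) : Type := Lp ℂ 2 (volume : Measure (Conf d))

/-- The Schwartz space of `ℝ^d`. -/
abbrev Sch (d : ℕ) : Type := 𝓢(Conf d, ℂ)

/-- The group of unitary operators of `L²(ℝ^d)`; the product is composition and the inverse is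
the Hilbert-space adjoint. -/
abbrev U2 (d : ℕ) : Type := L2 d ≃ₗᵢ[ℂ] L2 d

/-! ### Weighted affine substitutions `ψ ↦ √|det L| u(x) ψ(L x + b)` with `|u| = 1` -/

variable {d : ℕ}

/-- The affine map `x ↦ L x + b`. -/
def affineMap (L : Matrix (Fin d) (Fin d) ℝ) (b : Conf d) (x : Conf d) : Conf d :=
  Matrix.toEuclideanCLM (𝕜 := ℝ) L x + b

/-- The function `x ↦ √|det L| u(x) f(L x + b)`. -/
def affineFun (L : Matrix (Fin d) (Fin d) ℝ) (b : Conf d) (u : Conf d → Circle)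
    (f : Conf d → ℂ) (x : Conf d) : ℂ :=
  ((Real.sqrt |L.det| : ℝ) : ℂ) * (u x : ℂ) * f (affineMap L b x)

theorem continuous_affineMap (L : Matrix (Fin d) (Fin d) ℝ) (b : Conf d) :
    Continuous (affineMap L b) :=
  (Matrix.toEuclideanCLM (𝕜 := ℝ) L).continuous.add continuous_const

theorem map_affineMap (L : Matrix (Fin d) (Fin d) ℝ) (hL : L.det ≠ 0) (b : Conf d) :
    Measure.map (affineMap L b) (volume : Measure (Conf d))
      = ENNReal.ofReal |(L.det)⁻¹| • (volume : Measure (Conf d)) := by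
  have hdet : LinearMap.det (Matrix.toEuclideanLin (𝕜 := ℝ) L) = L.det := by
    rw [Matrix.toEuclideanLin_eq_toLin_orthonormal, LinearMap.det_toLin]
  have h1 : affineMap L b = (fun y => y + b) ∘ (Matrix.toEuclideanLin (𝕜 := ℝ) L) := by
    funext x; rfl
  have h2 : Measurable (Matrix.toEuclideanLin (𝕜 := ℝ) L) :=
    (Matrix.toEuclideanCLM (𝕜 := ℝ) L).continuous.measurable
  rw [h1, ← Measure.map_map (measurable_add_const b) h2,
    Measure.map_linearMap_addHaar_eq_smul_addHaar _ (by rw [hdet]; exact hL), hdet,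
    Measure.map_smul, map_add_right_eq_self]

theorem quasi_affineMap (L : Matrix (Fin d) (Fin d) ℝ) (hL : L.det ≠ 0) (b : Conf d) :
    Measure.QuasiMeasurePreserving (affineMap L b) volume volume :=
  ⟨(continuous_affineMap L b).measurable, by
    rw [map_affineMap L hL b]; exact Measure.smul_absolutelyContinuous⟩

theorem eLpNorm_affineFun (L : Matrix (Fin d) (Fin d) ℝ) (hL : L.det ≠ 0) (b : Conf d)
    (u : Conf d → Circle) (f : Conf d → ℂ) (hf : AEStronglyMeasurable f volume) :
    eLpNorm (affineFun L b u f) 2 volume = eLpNorm f 2 volume := by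
  have h1 : eLpNorm (affineFun L b u f) 2 volume
      = eLpNorm ((Real.sqrt |L.det|) • (f ∘ affineMap L b)) 2 volume := by
    apply eLpNorm_congr_norm_ae
    filter_upwards with x
    simp [affineFun, abs_of_nonneg (Real.sqrt_nonneg _), Circle.norm_coe (u x)]
  have hf' : AEStronglyMeasurable f (Measure.map (affineMap L b) volume) :=
    hf.mono_ac (quasi_affineMap L hL b).absolutelyContinuous
  rw [h1, eLpNorm_const_smul,
    ← eLpNorm_map_measure hf' (continuous_affineMap L b).aemeasurable, map_affineMap L hL b,
    eLpNorm_smul_measure_of_ne_top (by simp)]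
  have hpos : 0 < |L.det| := abs_pos.mpr hL
  rw [smul_eq_mul, ← mul_assoc]
  have : ‖Real.sqrt |L.det|‖ₑ * ENNReal.ofReal |(L.det)⁻¹| ^ (1 / (2 : ENNReal)).toReal = 1 := by
    rw [Real.enorm_eq_ofReal (Real.sqrt_nonneg _), ENNReal.ofReal_rpow_of_pos (by positivity),
      ← ENNReal.ofReal_mul (Real.sqrt_nonneg _), abs_inv, Real.sqrt_eq_rpow]
    have h2 : (1 / (2 : ENNReal)).toReal = 1 / 2 := by simp
    rw [h2, ← Real.mul_rpow hpos.le (by positivity), mul_inv_cancel₀ hpos.ne']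
    simp
  rw [this, one_mul]

theorem memLp_affineFun (L : Matrix (Fin d) (Fin d) ℝ) (hL : L.det ≠ 0) (b : Conf d)
    (u : Conf d → Circle) (hu : Continuous u) (f : Conf d → ℂ) (hf : MemLp f 2 volume) :
    MemLp (affineFun L b u f) 2 volume := by
  refine ⟨?_, ?_⟩
  · refine AEStronglyMeasurable.mul ?_ (hf.1.comp_quasiMeasurePreserving (quasi_affineMap L hL b))
    exact (continuous_const.mul (continuous_subtype_val.comp hu)).aestronglyMeasurable
  · rw [eLpNorm_affineFun L hL b u f hf.1]; exact hf.2

theorem affineFun_congr (L : Matrix (Fin d) (Fin d) ℝ) (hL : L.det ≠ 0) (b : Conf d)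
    (u : Conf d → Circle) {f g : Conf d → ℂ} (h : f =ᵐ[volume] g) :
    affineFun L b u f =ᵐ[volume] affineFun L b u g := by
  filter_upwards [(quasi_affineMap L hL b).ae_eq_comp h] with x hx
  have hx' : f (affineMap L b x) = g (affineMap L b x) := hx
  simp only [affineFun, hx']

/-- The isometry of `L²(ℝ^d)` given by `ψ ↦ √|det L| u(x) ψ(L x + b)`. -/
def affineIsometry (L : Matrix (Fin d) (Fin d) ℝ) (hL : L.det ≠ 0) (b : Conf d)
    (u : Conf d → Circle) (hu : Continuous u) : L2 d →ₗᵢ[ℂ] L2 d where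
  toFun f := (memLp_affineFun L hL b u hu f (Lp.memLp f)).toLp _
  map_add' f g := by
    refine Lp.ext ?_
    refine (MemLp.coeFn_toLp _).trans ?_
    refine (affineFun_congr L hL b u (Lp.coeFn_add f g)).trans ?_
    refine Filter.EventuallyEq.trans ?_ (Lp.coeFn_add _ _).symm
    filter_upwards [MemLp.coeFn_toLp (memLp_affineFun L hL b u hu f (Lp.memLp f)),
      MemLp.coeFn_toLp (memLp_affineFun L hL b u hu g (Lp.memLp g))] with x h1 h2
    simp only [Pi.add_apply, h1, h2, affineFun, mul_add]
  map_smul' c f := by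
    refine Lp.ext ?_
    refine (MemLp.coeFn_toLp _).trans ?_
    refine (affineFun_congr L hL b u (Lp.coeFn_smul c f)).trans ?_
    refine Filter.EventuallyEq.trans ?_ (Lp.coeFn_smul _ _).symm
    filter_upwards [MemLp.coeFn_toLp (memLp_affineFun L hL b u hu f (Lp.memLp f))] with x h1
    simp only [Pi.smul_apply, RingHom.id_apply, h1, affineFun, smul_eq_mul]
    ring
  norm_map' f := by
    change ‖(memLp_affineFun L hL b u hu f (Lp.memLp f)).toLp _‖ = ‖f‖
    rw [Lp.norm_toLp, eLpNorm_affineFun L hL b u f (Lp.memLp f).1, Lp.norm_def]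

theorem coeFn_affineIsometry (L : Matrix (Fin d) (Fin d) ℝ) (hL : L.det ≠ 0) (b : Conf d)
    (u : Conf d → Circle) (hu : Continuous u) (f : L2 d) :
    affineIsometry L hL b u hu f =ᵐ[volume] affineFun L b u f :=
  MemLp.coeFn_toLp (memLp_affineFun L hL b u hu f (Lp.memLp f))

theorem affineMap_affineMap_inv (L : Matrix (Fin d) (Fin d) ℝ) (hL : L.det ≠ 0) (b x : Conf d) :
    affineMap L b (affineMap L⁻¹ (-(Matrix.toEuclideanCLM (𝕜 := ℝ) L⁻¹ b)) x) = x := by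
  have h : L * L⁻¹ = 1 := Matrix.mul_nonsing_inv L (isUnit_iff_ne_zero.mpr hL)
  have h' : ∀ y, Matrix.toEuclideanCLM (𝕜 := ℝ) L (Matrix.toEuclideanCLM (𝕜 := ℝ) L⁻¹ y) = y := by
    intro y
    rw [← mul_apply_eq_comp, ← map_mul, h, map_one, one_apply_eq_self]
  simp only [affineMap, map_add, map_neg, h']
  abel

theorem affineIsometry_surjective (L : Matrix (Fin d) (Fin d) ℝ) (hL : L.det ≠ 0) (b : Conf d)
    (u : Conf d → Circle) (hu : Continuous u) :
    Function.Surjective (affineIsometry L hL b u hu) := by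
  intro g
  have hL' : (L⁻¹).det ≠ 0 := by
    rw [Matrix.det_nonsing_inv, Ring.inverse_eq_inv']; exact inv_ne_zero hL
  set b' : Conf d := -(Matrix.toEuclideanCLM (𝕜 := ℝ) L⁻¹ b) with hb'
  have hu' : Continuous fun x => (u (affineMap L⁻¹ b' x))⁻¹ :=
    (hu.comp (continuous_affineMap L⁻¹ b')).inv
  refine ⟨affineIsometry L⁻¹ hL' b' (fun x => (u (affineMap L⁻¹ b' x))⁻¹) hu' g, ?_⟩
  refine Lp.ext ?_
  refine (coeFn_affineIsometry L hL b u hu _).trans ?_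
  refine (affineFun_congr L hL b u (coeFn_affineIsometry L⁻¹ hL' b' _ hu' g)).trans ?_
  filter_upwards with x
  have hinv : affineMap L⁻¹ b' (affineMap L b x) = x := by
    have h : L⁻¹ * L = 1 := Matrix.nonsing_inv_mul L (isUnit_iff_ne_zero.mpr hL)
    simp only [affineMap, hb', map_add]
    rw [← mul_apply_eq_comp, ← map_mul, h, map_one, one_apply_eq_self]
    abel
  have hpos : 0 < |L.det| := abs_pos.mpr hL
  have hs : Real.sqrt |L.det| * Real.sqrt |(L⁻¹).det| = 1 := by
    rw [← Real.sqrt_mul (abs_nonneg _), ← abs_mul, ← Matrix.det_mul,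
      Matrix.mul_nonsing_inv L (isUnit_iff_ne_zero.mpr hL)]
    simp
  have hs' : ((Real.sqrt |L.det| : ℝ) : ℂ) * ((Real.sqrt |(L⁻¹).det| : ℝ) : ℂ) = 1 := by
    rw [← Complex.ofReal_mul, hs, Complex.ofReal_one]
  have hc : (u x : ℂ) * (((u x)⁻¹ : Circle) : ℂ) = 1 := by
    rw [← Circle.coe_mul, mul_inv_cancel, Circle.coe_one]
  simp only [affineFun, hinv]
  calc _ = (((Real.sqrt |L.det| : ℝ) : ℂ) * ((Real.sqrt |(L⁻¹).det| : ℝ) : ℂ))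
        * ((u x : ℂ) * (((u x)⁻¹ : Circle) : ℂ)) * g x := by ring
    _ = g x := by rw [hs', hc]; ring

/-- The unitary operator `ψ ↦ √|det L| u(x) ψ(L x + b)` of `L²(ℝ^d)`, where `det L ≠ 0` and
`u` is a continuous function with values in the unit circle. -/
def affineUnitary (L : Matrix (Fin d) (Fin d) ℝ) (hL : L.det ≠ 0) (b : Conf d)
    (u : Conf d → Circle) (hu : Continuous u) : U2 d :=
  LinearIsometryEquiv.ofSurjective (affineIsometry L hL b u hu)
    (affineIsometry_surjective L hL b u hu)

theorem coeFn_affineUnitary (L : Matrix (Fin d) (Fin d) ℝ) (hL : L.det ≠ 0) (b : Conf d)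
    (u : Conf d → Circle) (hu : Continuous u) (f : L2 d) :
    affineUnitary L hL b u hu f =ᵐ[volume] affineFun L b u f :=
  coeFn_affineIsometry L hL b u hu f

/-! ### The Heisenberg–Weyl operator -/

/-- The Heisenberg–Weyl operator `T_z`, `z = (q, p)`,
`(T_z f)(x) = exp((i/ħ) p·(x - q/2)) f(x - q)`. -/
def heisenbergWeyl (ħ : ℝ) (q p : Conf d) : U2 d :=
  affineUnitary 1 (by simp) (-q)
    (fun x => Circle.exp (inner ℝ p (x - (1 / 2 : ℝ) • q) / ħ)) (by fun_prop)

theorem heisenbergWeyl_apply (ħ : ℝ) (q p : Conf d) (f : L2 d) :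
    heisenbergWeyl ħ q p f =ᵐ[volume] fun x =>
      cexp (I / ħ * (inner ℝ p (x - (1 / 2 : ℝ) • q) : ℝ)) * f (x - q) := by
  refine (coeFn_affineUnitary _ _ _ _ _ f).trans ?_
  filter_upwards with x
  simp only [affineFun, affineMap, Matrix.det_one, abs_one, Real.sqrt_one, ofReal_one, one_mul,
    map_one, one_apply_eq_self, ← sub_eq_add_neg, Circle.coe_exp]
  congr 2
  push_cast
  ring

/-! ### The metaplectic group and its projection onto the symplectic group -/

theorem det_scalar_ne_zero (d : ℕ) (ħ : ℝ) (hħ : 0 < ħ) :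
    ((2 * Real.pi * ħ)⁻¹ • (1 : Matrix (Fin d) (Fin d) ℝ)).det ≠ 0 := by
  rw [Matrix.det_smul, Matrix.det_one, mul_one]; positivity

/-- The unitary operator `ψ ↦ i^{-d/2} (2πħ)^{-d/2} ψ(x / (2πħ))`. -/
def dilation (d : ℕ) (ħ : ℝ) (hħ : 0 < ħ) : U2 d :=
  affineUnitary ((2 * Real.pi * ħ)⁻¹ • (1 : Matrix (Fin d) (Fin d) ℝ)) (det_scalar_ne_zero d ħ hħ) 0
    (fun _ => Circle.exp (-(Real.pi * d / 4))) continuous_const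

/-- `Ĵ = i^{-d/2} F_ħ`, where `(F_ħ ψ)(x) = (2πħ)^{-d/2} (𝓕 ψ)(x / (2πħ))` is the semiclassical
Fourier transform written through Mathlib's unitary Fourier transform `𝓕` of `L²(ℝ^d)`. -/
def Jhat (d : ℕ) (ħ : ℝ) (hħ : 0 < ħ) : U2 d :=
  dilation d ħ hħ * Lp.fourierTransformₗᵢ (Conf d) ℂ

theorem Jhat_const (d : ℕ) (ħ : ℝ) (hħ : 0 < ħ) :
    ((Real.sqrt |((2 * Real.pi * ħ)⁻¹ • (1 : Matrix (Fin d) (Fin d) ℝ)).det| : ℝ) : ℂ)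
      * (Circle.exp (-(Real.pi * d / 4)) : ℂ) = (2 * Real.pi * ħ * I : ℂ) ^ (-(d : ℂ) / 2) := by
  have hc : (0 : ℝ) < 2 * Real.pi * ħ := by positivity
  rw [Matrix.det_smul, Matrix.det_one, mul_one, Fintype.card_fin, Circle.coe_exp,
    abs_of_pos (by positivity)]
  have hb : (2 * Real.pi * ħ * I : ℂ) = ((2 * Real.pi * ħ : ℝ) : ℂ) * I := by push_cast; ring
  have hne : ((2 * Real.pi * ħ : ℝ) : ℂ) * I ≠ 0 :=
    mul_ne_zero (by exact_mod_cast hc.ne') I_ne_zero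
  have hlog : Complex.log (((2 * Real.pi * ħ : ℝ) : ℂ) * I)
      = (Real.log (2 * Real.pi * ħ) : ℝ) + (Real.pi / 2) * I := by
    rw [Complex.log_ofReal_mul hc I_ne_zero, Complex.log_I]
  rw [hb, Complex.cpow_def_of_ne_zero hne, hlog]
  have hs : Real.sqrt ((2 * Real.pi * ħ)⁻¹ ^ d)
      = Real.exp (Real.log (2 * Real.pi * ħ) * (-(d : ℝ) / 2)) := by
    rw [Real.sqrt_eq_rpow, ← Real.rpow_natCast, ← Real.rpow_mul (by positivity),
      Real.rpow_def_of_pos (by positivity), Real.log_inv]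
    congr 1
    ring
  rw [hs, Complex.ofReal_exp, ← Complex.exp_add]
  congr 1
  push_cast
  ring

theorem fourier_scaled (ħ : ℝ) (hħ : 0 < ħ) (ψ : Conf d → ℂ) (x : Conf d) :
    𝓕 ψ ((2 * Real.pi * ħ)⁻¹ • x)
      = ∫ y : Conf d, cexp (-(I / ħ) * (inner ℝ x y : ℝ)) * ψ y := by
  rw [Real.fourier_eq']
  refine integral_congr_ae (Filter.Eventually.of_forall fun y => ?_)
  have hpi : (Real.pi : ℂ) ≠ 0 := by exact_mod_cast Real.pi_ne_zero
  have hh : (ħ : ℂ) ≠ 0 := by exact_mod_cast hħ.ne'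
  simp only [smul_eq_mul]
  rw [real_inner_smul_right, real_inner_comm x y]
  congr 2
  push_cast
  field_simp

/-- On Schwartz functions, `(Ĵ ψ)(x) = (2πħ i)^{-d/2} ∫ exp(-(i/ħ) x·y) ψ(y) dy`. -/
theorem Jhat_apply (ħ : ℝ) (hħ : 0 < ħ) (ψ : Sch d) :
    (Jhat d ħ hħ (ψ.toLp 2) : Conf d → ℂ) =ᵐ[volume] fun x =>
      (2 * Real.pi * ħ * I : ℂ) ^ (-(d : ℂ) / 2) *
        ∫ y : Conf d, cexp (-(I / ħ) * (inner ℝ x y : ℝ)) * ψ y := by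
  have h0 : Lp.fourierTransformₗᵢ (Conf d) ℂ (ψ.toLp 2) = (𝓕 ψ).toLp 2 :=
    SchwartzMap.toLp_fourier_eq ψ
  have h1 : ((𝓕 ψ).toLp 2 : L2 d) =ᵐ[volume] ((𝓕 ψ : Sch d) : Conf d → ℂ) :=
    SchwartzMap.coeFn_toLp (𝓕 ψ : Sch d) 2 volume
  have h2 : Jhat d ħ hħ (ψ.toLp 2) = dilation d ħ hħ ((𝓕 ψ).toLp 2) := by
    rw [Jhat, LinearIsometryEquiv.coe_mul, Function.comp_apply, h0]
  have h3 := coeFn_affineUnitary ((2 * Real.pi * ħ)⁻¹ • (1 : Matrix (Fin d) (Fin d) ℝ))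
    (det_scalar_ne_zero d ħ hħ) 0 (fun _ => Circle.exp (-(Real.pi * d / 4))) continuous_const
    ((𝓕 ψ).toLp 2)
  have h4 := affineFun_congr ((2 * Real.pi * ħ)⁻¹ • (1 : Matrix (Fin d) (Fin d) ℝ))
    (det_scalar_ne_zero d ħ hħ) 0 (fun _ => Circle.exp (-(Real.pi * d / 4))) h1
  rw [h2]
  refine h3.trans (h4.trans (Filter.Eventually.of_forall fun x => ?_))
  have h5 : affineMap ((2 * Real.pi * ħ)⁻¹ • (1 : Matrix (Fin d) (Fin d) ℝ)) 0 x
      = (2 * Real.pi * ħ)⁻¹ • x := by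
    rw [affineMap, add_zero, map_smul, map_one]; rfl
  rw [affineFun, h5, Jhat_const d ħ hħ, SchwartzMap.fourier_coe, fourier_scaled ħ hħ]

/-- `(V̂_R ψ)(x) = exp((i/2ħ) xᵀ R x) ψ(x)`. -/
def Vhat (ħ : ℝ) (R : Matrix (Fin d) (Fin d) ℝ) : U2 d :=
  affineUnitary 1 (by simp) 0
    (fun x => Circle.exp (inner ℝ x (Matrix.toEuclideanCLM (𝕜 := ℝ) R x) / (2 * ħ))) (by fun_prop)

theorem Vhat_apply (ħ : ℝ) (R : Matrix (Fin d) (Fin d) ℝ) (f : L2 d) :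
    Vhat ħ R f =ᵐ[volume] fun x =>
      cexp (I / (2 * ħ) * ((x.ofLp ⬝ᵥ (R *ᵥ x.ofLp) : ℝ) : ℂ)) * f x := by
  refine (coeFn_affineUnitary _ _ _ _ _ f).trans ?_
  filter_upwards with x
  have h : inner ℝ x (Matrix.toEuclideanCLM (𝕜 := ℝ) R x) = x.ofLp ⬝ᵥ (R *ᵥ x.ofLp) := by
    rw [EuclideanSpace.inner_eq_star_dotProduct, Matrix.ofLp_toEuclideanCLM, dotProduct_comm]
    simp
  simp only [affineFun, affineMap, Matrix.det_one, abs_one, Real.sqrt_one, ofReal_one, one_mul,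
    map_one, one_apply_eq_self, add_zero, Circle.coe_exp, h]
  congr 2
  push_cast
  ring

/-- `(M̂_L^m ψ)(x) = i^m √|det L| ψ(L x)`. -/
def Mhat (L : Matrix (Fin d) (Fin d) ℝ) (hL : L.det ≠ 0) (m : ℤ) : U2 d :=
  affineUnitary L hL 0 (fun _ => Circle.exp (Real.pi / 2) ^ m) continuous_const

theorem Mhat_apply (L : Matrix (Fin d) (Fin d) ℝ) (hL : L.det ≠ 0) (m : ℤ) (f : L2 d) :
    Mhat L hL m f =ᵐ[volume] fun x =>
      I ^ m * ((Real.sqrt |L.det| : ℝ) : ℂ) * f (Matrix.toEuclideanCLM (𝕜 := ℝ) L x) := by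
  refine (coeFn_affineUnitary _ _ _ _ _ f).trans ?_
  filter_upwards with x
  have h : ((Circle.exp (Real.pi / 2) ^ m : Circle) : ℂ) = I ^ m := by
    rw [Circle.coe_zpow, Circle.coe_exp]
    push_cast
    rw [Complex.exp_pi_div_two_mul_I]
  simp only [affineFun, affineMap, add_zero, h]
  ring

/-- The matrix `J = [[0, I], [-I, 0]]`. -/
def matJ (d : ℕ) (K : Type*) [CommRing K] : Matrix (Fin d ⊕ Fin d) (Fin d ⊕ Fin d) K :=
  Matrix.fromBlocks 0 1 (-1) 0

/-- The real symplectic group `Sp(2d, ℝ)`. -/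
abbrev Sp (d : ℕ) : Type := Matrix.symplecticGroup (Fin d) ℝ

theorem mem_Sp_iff (S : Matrix (Fin d ⊕ Fin d) (Fin d ⊕ Fin d) ℝ) :
    S ∈ Matrix.symplecticGroup (Fin d) ℝ ↔ Sᵀ * matJ d ℝ * S = matJ d ℝ := by
  have h : matJ d ℝ = -Matrix.J (Fin d) ℝ := by
    simp [matJ, Matrix.J, Matrix.fromBlocks_neg]
  rw [SymplecticGroup.mem_iff', h]
  simp

/-- `J` as an element of `Sp(2d, ℝ)`. -/
def spJ (d : ℕ) : Sp d :=
  ⟨matJ d ℝ, by rw [matJ, SymplecticGroup.fromBlocks_mem_iff]; simp⟩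

/-- `V_R = [[I, 0], [R, I]]`, for symmetric `R`. -/
def spV (R : Matrix (Fin d) (Fin d) ℝ) (hR : R.IsSymm) : Sp d :=
  ⟨Matrix.fromBlocks 1 0 R 1, by
    rw [SymplecticGroup.fromBlocks_mem_iff]; simp [hR.eq]⟩

/-- `M_L = [[L⁻¹, 0], [0, Lᵀ]]`, for invertible `L`. -/
def spM (L : Matrix (Fin d) (Fin d) ℝ) (hL : L.det ≠ 0) : Sp d :=
  ⟨Matrix.fromBlocks L⁻¹ 0 0 Lᵀ, by
    rw [SymplecticGroup.fromBlocks_mem_iff]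
    refine ⟨by simp, by simp, ?_⟩
    rw [← Matrix.transpose_mul, Matrix.mul_nonsing_inv L (isUnit_iff_ne_zero.mpr hL)]
    simp⟩

/-- The generators of the metaplectic group, each paired with its symplectic matrix. The index
`m` of `M̂_L^m` satisfies `m π ≡ arg (det L)` modulo `2π`. -/
inductive IsGenerator (ħ : ℝ) (hħ : 0 < ħ) : U2 d × Sp d → Prop
  | J : IsGenerator ħ hħ (Jhat d ħ hħ, spJ d)
  | V (R : Matrix (Fin d) (Fin d) ℝ) (hR : R.IsSymm) : IsGenerator ħ hħ (Vhat ħ R, spV R hR)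
  | M (L : Matrix (Fin d) (Fin d) ℝ) (hL : L.det ≠ 0) (m : ℤ)
      (hm : ∃ k : ℤ, (m : ℝ) * Real.pi = Complex.arg (L.det : ℂ) + 2 * Real.pi * k) :
      IsGenerator ħ hħ (Mhat L hL m, spM L hL)

/-- The graph of the projection `π_Mp : Mp(2d, ℝ) → Sp(2d, ℝ)`: the subgroup of
`U(L²(ℝ^d)) × Sp(2d, ℝ)` generated by `(Ĵ, J)`, `(V̂_R, V_R)` and `(M̂_L^m, M_L)`. -/
def metaplecticGraph (d : ℕ) (ħ : ℝ) (hħ : 0 < ħ) : Subgroup (U2 d × Sp d) :=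
  Subgroup.closure {g | IsGenerator ħ hħ g}

/-- The metaplectic group `Mp(2d, ℝ)`: the subgroup of `U(L²(ℝ^d))` generated by the operators
`Ĵ`, `V̂_R` and `M̂_L^m`. -/
def metaplecticGroup (d : ℕ) (ħ : ℝ) (hħ : 0 < ħ) : Subgroup (U2 d) :=
  Subgroup.closure (Prod.fst '' {g : U2 d × Sp d | IsGenerator ħ hħ g})

theorem mem_metaplecticGroup_iff (ħ : ℝ) (hħ : 0 < ħ) (U : U2 d) :
    U ∈ metaplecticGroup d ħ hħ ↔ ∃ S : Sp d, (U, S) ∈ metaplecticGraph d ħ hħ := by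
  have h : metaplecticGroup d ħ hħ
      = (metaplecticGraph d ħ hħ).map (MonoidHom.fst (U2 d) (Sp d)) := by
    rw [metaplecticGroup, metaplecticGraph, MonoidHom.map_closure]; rfl
  rw [h, Subgroup.mem_map]
  constructor
  · rintro ⟨⟨V, S⟩, hV, rfl⟩; exact ⟨S, hV⟩
  · rintro ⟨S, hS⟩; exact ⟨(U, S), hS, rfl⟩

/-- `U` is a metaplectic operator with `π_Mp(U) = S`. -/
def IsMetaplecticOver (ħ : ℝ) (hħ : 0 < ħ) (U : U2 d) (S : Sp d) : Prop :=
  (U, S) ∈ metaplecticGraph d ħ hħ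

/-! ### Position, momentum and ladder operators on the Schwartz space -/

/-- The position operator `x̂_j`. -/
def xhat (j : Fin d) : Sch d →ₗ[ℂ] Sch d :=
  (SchwartzMap.smulLeftCLM ℂ (fun x : Conf d => ((x j : ℝ) : ℂ))).toLinearMap

/-- The momentum operator `p̂_j = -iħ ∂/∂x_j`. -/
def phat (ħ : ℝ) (j : Fin d) : Sch d →ₗ[ℂ] Sch d :=
  (-(I * ħ)) • (LineDeriv.lineDerivOpCLM ℂ (Sch d) (EuclideanSpace.single j (1 : ℝ))).toLinearMap

theorem xhat_apply (j : Fin d) (f : Sch d) (x : Conf d) : xhat j f x = (x j : ℂ) * f x := by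
  have h : (fun x : Conf d => ((x j : ℝ) : ℂ)).HasTemperateGrowth :=
    (Complex.ofRealCLM.comp (EuclideanSpace.proj (𝕜 := ℝ) j)).hasTemperateGrowth
  exact SchwartzMap.smulLeftCLM_apply_apply h f x

theorem phat_apply (ħ : ℝ) (j : Fin d) (f : Sch d) (x : Conf d) :
    phat ħ j f x = -(I * ħ) * lineDeriv ℝ f x (EuclideanSpace.single j 1) := by
  change -(I * ħ) * (∂_{EuclideanSpace.single j (1 : ℝ)} f) x = _
  rw [SchwartzMap.lineDerivOp_apply]

/-- The `2d` operators `ẑ - z = (x̂ - q, p̂ - p)`; for `z = 0` these are `ẑ = (x̂, p̂)`. -/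
def zhatSub (ħ : ℝ) (q p : Conf d) : Fin d ⊕ Fin d → (Sch d →ₗ[ℂ] Sch d) :=
  Sum.elim (fun k => xhat k - (q k : ℂ) • LinearMap.id)
    (fun k => phat ħ k - (p k : ℂ) • LinearMap.id)

/-- `ρ(X; ẑ) = Xᵀ J ẑ`. The components `Sum.inl j` form `ρ^♭`, the components `Sum.inr j` form
`ρ^♯`. -/
def rho (X : Matrix (Fin d ⊕ Fin d) (Fin d ⊕ Fin d) ℂ)
    (zh : Fin d ⊕ Fin d → (Sch d →ₗ[ℂ] Sch d)) (j : Fin d ⊕ Fin d) : Sch d →ₗ[ℂ] Sch d :=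
  ∑ k, (Xᵀ * matJ d ℂ) j k • zh k

/-- `W_ħ = (2ħ)^{-1/2} [[i I, -i I], [-I, -I]]`. -/
def Wmat (d : ℕ) (ħ : ℝ) : Matrix (Fin d ⊕ Fin d) (Fin d ⊕ Fin d) ℂ :=
  (1 / (Real.sqrt (2 * ħ) : ℂ)) • Matrix.fromBlocks (I • 1) (-I • 1) (-1) (-1)

/-- The harmonic-oscillator lowering operator `â_j = (2ħ)^{-1/2} (x̂_j + i p̂_j)`. -/
def aLower (ħ : ℝ) (j : Fin d) : Sch d →ₗ[ℂ] Sch d :=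
  (1 / (Real.sqrt (2 * ħ) : ℂ)) • (xhat j + I • phat ħ j)

/-- The harmonic-oscillator raising operator `â*_j = (2ħ)^{-1/2} (x̂_j - i p̂_j)`. -/
def aRaise (ħ : ℝ) (j : Fin d) : Sch d →ₗ[ℂ] Sch d :=
  (1 / (Real.sqrt (2 * ħ) : ℂ)) • (xhat j - I • phat ħ j)

/-- The Hagedorn lowering operator `𝒜_j(S, z) = ρ^♭_j(S W_ħ; ẑ - z)`. -/
def hagLower (ħ : ℝ) (S : Sp d) (q p : Conf d) (j : Fin d) : Sch d →ₗ[ℂ] Sch d :=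
  rho ((S : Matrix (Fin d ⊕ Fin d) (Fin d ⊕ Fin d) ℝ).map Complex.ofReal * Wmat d ħ)
    (zhatSub ħ q p) (Sum.inl j)

/-- The Hagedorn raising operator `𝒜*_j(S, z) = ρ^♯_j(S W_ħ; ẑ - z)`. -/
def hagRaise (ħ : ℝ) (S : Sp d) (q p : Conf d) (j : Fin d) : Sch d →ₗ[ℂ] Sch d :=
  rho ((S : Matrix (Fin d ⊕ Fin d) (Fin d ⊕ Fin d) ℝ).map Complex.ofReal * Wmat d ħ)
    (zhatSub ħ q p) (Sum.inr j)

/-- `â_j = ρ^♭_j(W_ħ; ẑ)`. -/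
theorem rho_Wmat_inl (ħ : ℝ) (j : Fin d) :
    rho (Wmat d ħ) (zhatSub ħ 0 0) (Sum.inl j) = aLower ħ j := by
  simp [rho, Wmat, matJ, aLower, zhatSub, Matrix.fromBlocks_transpose,
    Matrix.fromBlocks_multiply, Matrix.one_apply, smul_smul, Finset.sum_ite_eq]

/-- `â*_j = ρ^♯_j(W_ħ; ẑ)`. -/
theorem rho_Wmat_inr (ħ : ℝ) (j : Fin d) :
    rho (Wmat d ħ) (zhatSub ħ 0 0) (Sum.inr j) = aRaise ħ j := by
  simp [rho, Wmat, matJ, aRaise, zhatSub, Matrix.fromBlocks_transpose,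
    Matrix.fromBlocks_multiply, Matrix.one_apply, smul_smul, sub_eq_add_neg]

/-! ### Unbounded operators on `L²(ℝ^d)` -/

/-- The inclusion of the Schwartz space in `L²(ℝ^d)`. -/
def schToL2 (d : ℕ) : Sch d →ₗ[ℂ] L2 d :=
  (SchwartzMap.toLpCLM ℂ ℂ 2 (volume : Measure (Conf d))).toLinearMap

theorem schToL2_injective (d : ℕ) : Function.Injective (schToL2 d) :=
  SchwartzMap.injective_toLp 2 volume

/-- A linear operator on the Schwartz space, regarded as an unbounded operator on `L²(ℝ^d)` with
domain the Schwartz space. -/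
def toUnbounded (A : Sch d →ₗ[ℂ] Sch d) : L2 d →ₗ.[ℂ] L2 d where
  domain := LinearMap.range (schToL2 d)
  toFun := schToL2 d ∘ₗ A ∘ₗ
    (LinearEquiv.ofInjective (schToL2 d) (schToL2_injective d)).symm.toLinearMap

/-- The conjugate `U B U*` of an unbounded operator by a unitary operator, on its natural domain
`{f | U* f ∈ dom B}`. -/
def conjUnbounded (U : U2 d) (B : L2 d →ₗ.[ℂ] L2 d) : L2 d →ₗ.[ℂ] L2 d where
  domain := B.domain.comap U.symm.toLinearEquiv.toLinearMap
  toFun := U.toLinearEquiv.toLinearMap ∘ₗ B.toFun ∘ₗ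
    U.symm.toLinearEquiv.toLinearMap.restrict (fun _ hx => hx)

end Hagedorn

end

namespace Hagedorn

noncomputable section

variable {d : ℕ}

/-! ### Functions of temperate growth -/

/-! The theorem rests on an exact Egorov relation. Every metaplectic operator over `S` restricts to
an automorphism `Φ` of the Schwartz space with `ẑ Φ = Φ S ẑ`, where `S` mixes the 2d components
(`IsMetaplecticOver.exists_intertwines`). Pairs (operator, matrix) with this property are closed
under products and inverses, so only the three families of generators need a computation: the chain
rule for dilations, the gradient of a quadratic phase, and the exchange of position and momentum by
the Fourier transform. The induction runs on the graph of the projection, so its single-valuedness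
never enters.

The Heisenberg–Weyl operator likewise restricts to `Ψ` with `(ẑ - z) Ψ = Ψ ẑ`. Together these give
`(ẑ - z) ΨΦ = ΨΦ S ẑ`, and `Sᵀ J S = J` turns `(S W)ᵀ J S` into `Wᵀ J`; hence the Hagedorn operators
composed with `ΨΦ` equal `ΨΦ` composed with the harmonic-oscillator ones (`rho_mul_apply`).

The rest follows from this intertwining. As `ΨΦ` maps the Schwartz space onto itself, the natural
domain of the conjugated operator is exactly the Schwartz space (`toUnbounded_eq_conjUnbounded`).
Unitarity transports the formal adjointness of the oscillator operators, which is integration by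
parts (`inner_conj_left`, `inner_aLower_left`). The explicit formulas are block-matrix algebra
(`transpose_mul_Wmat_mul_matJ`). -/

theorem hasTemperateGrowth_cexp_ofReal_mul_I :
    (fun t : ℝ => cexp (t * I)).HasTemperateGrowth := by
  have hd : ∀ t : ℝ, HasDerivAt (fun t : ℝ => cexp (t * I)) (I * cexp (t * I)) t := fun t => by
    simpa [mul_comm] using ((hasDerivAt_id (t : ℂ)).mul_const I).cexp.comp_ofReal
  have hn : ∀ n : ℕ, iteratedDeriv n (fun t : ℝ => cexp (t * I))
      = fun t : ℝ => I ^ n * cexp (t * I) := by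
    intro n
    induction n with
    | zero => simp
    | succ n ih =>
      rw [iteratedDeriv_succ, ih]
      funext t
      rw [((hd t).const_mul (I ^ n)).deriv, pow_succ, mul_assoc]
  -- All derivatives have modulus one, hence growth exponent 0 and constant 1.
  refine ⟨(ofRealCLM.contDiff.mul contDiff_const).cexp, fun n => ⟨0, 1, fun t => ?_⟩⟩
  rw [norm_iteratedFDeriv_eq_norm_iteratedDeriv, hn]
  simp [Complex.norm_exp_ofReal_mul_I]

theorem hasTemperateGrowth_circleExp {θ : Conf d → ℝ} (hθ : θ.HasTemperateGrowth) :
    (fun x => (Circle.exp (θ x) : ℂ)).HasTemperateGrowth := by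
  simpa only [Circle.coe_exp, Function.comp_def]
    using hasTemperateGrowth_cexp_ofReal_mul_I.comp hθ

theorem hasTemperateGrowth_affineMap (L : Matrix (Fin d) (Fin d) ℝ) (b : Conf d) :
    (affineMap L b).HasTemperateGrowth :=
  (Matrix.toEuclideanCLM (𝕜 := ℝ) L).hasTemperateGrowth.add (.const b)

theorem affineMap_inv_affineMap (L : Matrix (Fin d) (Fin d) ℝ) (hL : L.det ≠ 0) (b x : Conf d) :
    affineMap L⁻¹ (-(Matrix.toEuclideanCLM (𝕜 := ℝ) L⁻¹ b)) (affineMap L b x) = x := by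
  have h : L⁻¹ * L = 1 := Matrix.nonsing_inv_mul L (isUnit_iff_ne_zero.mpr hL)
  simp only [affineMap, map_add]
  rw [← mul_apply_eq_comp, ← map_mul, h, map_one, one_apply_eq_self]
  abel

/-- This is the properness condition required by `SchwartzMap.compCLM`. Writing `x` as the inverse
affine map applied to `y = L x + b` gives a bound `α‖y‖ + β`, which is at most `(α + β)(1 + ‖y‖)`.
-/
theorem exists_norm_le_affineMap (L : Matrix (Fin d) (Fin d) ℝ) (hL : L.det ≠ 0) (b : Conf d) :
    ∃ (k : ℕ) (C : ℝ), ∀ x, ‖x‖ ≤ C * (1 + ‖affineMap L b x‖) ^ k := by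
  set b' : Conf d := -(Matrix.toEuclideanCLM (𝕜 := ℝ) L⁻¹ b) with hb'
  refine ⟨1, ‖Matrix.toEuclideanCLM (𝕜 := ℝ) L⁻¹‖ + ‖b'‖, fun x => ?_⟩
  have h1 : ‖x‖ ≤ ‖Matrix.toEuclideanCLM (𝕜 := ℝ) L⁻¹‖ * ‖affineMap L b x‖ + ‖b'‖ := by
    conv_lhs => rw [← affineMap_inv_affineMap L hL b x]
    exact (norm_add_le _ _).trans (add_le_add_left (ContinuousLinearMap.le_opNorm _ _) _)
  nlinarith [norm_nonneg b', norm_nonneg (affineMap L b x),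
    norm_nonneg (Matrix.toEuclideanCLM (𝕜 := ℝ) L⁻¹),
    mul_nonneg (norm_nonneg b') (norm_nonneg (affineMap L b x))]

/-! ### Weighted affine substitutions on the Schwartz space -/

/-- The substitution `f ↦ (x ↦ √|det L| u(x) f(L x + b))` on the Schwartz space. -/
def schAffineHom (L : Matrix (Fin d) (Fin d) ℝ) (hL : L.det ≠ 0) (b : Conf d)
    (u : Conf d → Circle) : Sch d →ₗ[ℂ] Sch d :=
  ((Real.sqrt |L.det| : ℝ) : ℂ) • ((SchwartzMap.smulLeftCLM ℂ (fun x => (u x : ℂ))) ∘L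
    (SchwartzMap.compCLM ℂ (hasTemperateGrowth_affineMap L b)
      (exists_norm_le_affineMap L hL b))).toLinearMap

/-- `SchwartzMap.smulLeftCLM` accepts any function as multiplier; the growth condition `hu` is what
makes it act as pointwise multiplication. -/
theorem schAffineHom_apply (L : Matrix (Fin d) (Fin d) ℝ) (hL : L.det ≠ 0) (b : Conf d)
    (u : Conf d → Circle) (hu : (fun x => (u x : ℂ)).HasTemperateGrowth) (f : Sch d) (x : Conf d) :
    schAffineHom L hL b u f x = affineFun L b u f x := by
  simp only [schAffineHom, affineFun, mul_assoc]
  change _ * (SchwartzMap.smulLeftCLM ℂ (fun x => (u x : ℂ)) _) x = _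
  rw [SchwartzMap.smulLeftCLM_apply_apply hu]
  rfl

theorem schToL2_schAffineHom (L : Matrix (Fin d) (Fin d) ℝ) (hL : L.det ≠ 0) (b : Conf d)
    (u : Conf d → Circle) (hu : Continuous u) (hu' : (fun x => (u x : ℂ)).HasTemperateGrowth)
    (f : Sch d) :
    schToL2 d (schAffineHom L hL b u f) = affineUnitary L hL b u hu (schToL2 d f) := by
  refine Lp.ext ?_
  have h1 : ∀ g : Sch d, schToL2 d g =ᵐ[volume] (g : Conf d → ℂ) := fun g =>
    SchwartzMap.coeFn_toLp g 2 volume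
  refine (h1 _).trans (Filter.EventuallyEq.trans ?_ ((coeFn_affineUnitary L hL b u hu _).trans
    (affineFun_congr L hL b u (h1 f))).symm)
  exact Filter.Eventually.of_forall fun x => schAffineHom_apply L hL b u hu' f x

theorem schAffineHom_surjective (L : Matrix (Fin d) (Fin d) ℝ) (hL : L.det ≠ 0) (b : Conf d)
    (u : Conf d → Circle) (hu : (fun x => (u x : ℂ)).HasTemperateGrowth) :
    Function.Surjective (schAffineHom L hL b u) := by
  intro g
  have hL' : (L⁻¹).det ≠ 0 := by
    rw [Matrix.det_nonsing_inv, Ring.inverse_eq_inv']; exact inv_ne_zero hL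
  have hc : ((Real.sqrt |L.det| : ℝ) : ℂ) ≠ 0 := by
    exact_mod_cast (Real.sqrt_pos.mpr (abs_pos.mpr hL)).ne'
  have hu' : (fun x => (((u x)⁻¹ : Circle) : ℂ)).HasTemperateGrowth := by
    simpa only [Circle.coe_inv_eq_conj, Function.comp_def, ContinuousLinearEquiv.coe_coe,
      conjCLE_apply] using (conjCLE : ℂ →L[ℝ] ℂ).hasTemperateGrowth.comp hu
  -- The weight is removed before the inverse substitution, so that it is evaluated at the original
  -- point and its temperate growth needs only complex conjugation.
  refine ⟨((Real.sqrt |L.det| : ℝ) : ℂ)⁻¹ • SchwartzMap.compCLM ℂ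
    (hasTemperateGrowth_affineMap L⁻¹ (-(Matrix.toEuclideanCLM (𝕜 := ℝ) L⁻¹ b)))
    (exists_norm_le_affineMap L⁻¹ hL' _)
    (SchwartzMap.smulLeftCLM ℂ (fun x => (((u x)⁻¹ : Circle) : ℂ)) g), ?_⟩
  ext x
  rw [schAffineHom_apply L hL b u hu, affineFun, _root_.smul_apply, SchwartzMap.compCLM_apply,
    Function.comp_apply, affineMap_inv_affineMap L hL, SchwartzMap.smulLeftCLM_apply_apply hu',
    smul_eq_mul, smul_eq_mul, Circle.coe_inv]
  field_simp [Circle.coe_ne_zero]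

/-- The substitution `f ↦ (x ↦ √|det L| u(x) f(L x + b))` as an automorphism of the Schwartz
space. -/
def schAffine (L : Matrix (Fin d) (Fin d) ℝ) (hL : L.det ≠ 0) (b : Conf d)
    (u : Conf d → Circle) (hu : (fun x => (u x : ℂ)).HasTemperateGrowth) : Sch d ≃ₗ[ℂ] Sch d :=
  LinearEquiv.ofBijective (schAffineHom L hL b u)
    -- Injectivity is inherited from the unitary operator through the embedding into `L²`.
    ⟨fun f g h => schToL2_injective d <| by
      have hu' : Continuous u := Topology.IsInducing.subtypeVal.continuous_iff.mpr hu.1.continuous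
      apply (affineUnitary L hL b u hu').injective
      rw [← schToL2_schAffineHom L hL b u hu' hu, ← schToL2_schAffineHom L hL b u hu' hu, h],
    schAffineHom_surjective L hL b u hu⟩

theorem schAffine_apply (L : Matrix (Fin d) (Fin d) ℝ) (hL : L.det ≠ 0) (b : Conf d)
    (u : Conf d → Circle) (hu : (fun x => (u x : ℂ)).HasTemperateGrowth) (f : Sch d) (x : Conf d) :
    schAffine L hL b u hu f x = affineFun L b u f x :=
  schAffineHom_apply L hL b u hu f x

theorem schToL2_schAffine (L : Matrix (Fin d) (Fin d) ℝ) (hL : L.det ≠ 0) (b : Conf d)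
    (u : Conf d → Circle) (hu : Continuous u) (hu' : (fun x => (u x : ℂ)).HasTemperateGrowth)
    (f : Sch d) :
    schToL2 d (schAffine L hL b u hu' f) = affineUnitary L hL b u hu (schToL2 d f) :=
  schToL2_schAffineHom L hL b u hu hu' f

/-! ### Position and momentum under weighted affine substitutions. -/

theorem toEuclideanCLM_single (L : Matrix (Fin d) (Fin d) ℝ) (k : Fin d) :
    Matrix.toEuclideanCLM (𝕜 := ℝ) L (EuclideanSpace.single k 1)
      = ∑ l, L l k • EuclideanSpace.single l (1 : ℝ) := by
  ext i
  simp [Matrix.ofLp_toEuclideanCLM, Matrix.mulVec_single, Pi.single_apply]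

/-- If `∂_k u = (i/ħ) g u`, then the momentum operator acts on `√|det L| u(x) f(L x + b)` as
multiplication by `g` plus `Lᵀ` applied to the momenta of `f`. -/
theorem phat_schAffine (ħ : ℝ) (hħ : ħ ≠ 0) (L : Matrix (Fin d) (Fin d) ℝ) (hL : L.det ≠ 0)
    (b : Conf d) (u : Conf d → Circle) (hu : (fun x => (u x : ℂ)).HasTemperateGrowth)
    (k : Fin d) (g : ℂ) (x : Conf d)
    (hg : HasLineDerivAt ℝ (fun x => (u x : ℂ)) (I / ħ * g * u x) x (EuclideanSpace.single k 1))
    (f : Sch d) :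
    phat ħ k (schAffine L hL b u hu f) x = ((Real.sqrt |L.det| : ℝ) : ℂ) * u x *
      (g * f (affineMap L b x) + ∑ l, (L l k : ℂ) * phat ħ l f (affineMap L b x)) := by
  have hf : HasLineDerivAt ℝ (fun x => f (affineMap L b x))
      (∑ l, (L l k : ℂ) * lineDeriv ℝ f (affineMap L b x) (EuclideanSpace.single l 1)) x
      (EuclideanSpace.single k 1) := by
    have hA : HasFDerivAt (affineMap L b) (Matrix.toEuclideanCLM (𝕜 := ℝ) L) x :=
      (Matrix.toEuclideanCLM (𝕜 := ℝ) L).hasFDerivAt.add_const b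
    have hF : HasFDerivAt f (fderiv ℝ f (affineMap L b x)) (affineMap L b x) :=
      f.differentiableAt.hasFDerivAt
    -- The chain rule differentiates `f` along the `k`-th column of `L`; this is the origin of `Lᵀ`
    -- in the momentum block.
    have hs : ∑ l, (L l k : ℂ) * lineDeriv ℝ f (affineMap L b x) (EuclideanSpace.single l 1)
        = ((fderiv ℝ f (affineMap L b x)).comp (Matrix.toEuclideanCLM (𝕜 := ℝ) L))
          (EuclideanSpace.single k 1) := by
      rw [ContinuousLinearMap.comp_apply, toEuclideanCLM_single, map_sum]
      refine Finset.sum_congr rfl fun l _ => ?_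
      rw [map_smul, f.differentiableAt.lineDeriv_eq_fderiv, Complex.real_smul]
    rw [hs]
    exact (hF.comp x hA).hasLineDerivAt (EuclideanSpace.single k 1)
  have hfun : (schAffine L hL b u hu f : Conf d → ℂ) = fun x =>
      ((Real.sqrt |L.det| : ℝ) : ℂ) * ((u x : ℂ) * f (affineMap L b x)) := by
    funext y
    rw [schAffine_apply, affineFun, mul_assoc]
  have hh : (ħ : ℂ) ≠ 0 := by exact_mod_cast hħ
  have hm := HasDerivAt.const_mul ((Real.sqrt |L.det| : ℝ) : ℂ) (HasDerivAt.mul hg hf)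
  rw [phat_apply, hfun]
  simp only [phat_apply]
  rw [show lineDeriv ℝ (fun x => ((Real.sqrt |L.det| : ℝ) : ℂ) *
      ((u x : ℂ) * f (affineMap L b x))) x (EuclideanSpace.single k 1) = _ from hm.deriv]
  -- A line derivative is a derivative in `t` at `0`, so base points arrive as `x + 0 • v`.
  simp only [zero_smul, add_zero, mul_left_comm _ (-(I * (ħ : ℂ))) _, ← Finset.mul_sum]
  -- The prefactor `-(I * ħ)` times `I / ħ` is 1, which leaves `g` with coefficient one.
  field_simp
  ring_nf
  simp only [I_sq]
  ring

theorem xhat_schAffine (L : Matrix (Fin d) (Fin d) ℝ) (hL : L.det ≠ 0)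
    (b : Conf d) (u : Conf d → Circle) (hu : (fun x => (u x : ℂ)).HasTemperateGrowth)
    (k : Fin d) (f : Sch d) (x : Conf d) :
    xhat k (schAffine L hL b u hu f) x
      = ((Real.sqrt |L.det| : ℝ) : ℂ) * u x * ((x k : ℂ) * f (affineMap L b x)) := by
  rw [xhat_apply, schAffine_apply, affineFun]
  ring

end

end Hagedorn

namespace Hagedorn

noncomputable section

variable {d : ℕ}

/-! ### Egorov's theorem for metaplectic operators on the Schwartz space -/

/-- The Schwartz automorphism `Φ` is the restriction of the unitary operator `U`. -/
def IsRestriction (U : U2 d) (Φ : Sch d ≃ₗ[ℂ] Sch d) : Prop :=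
  ∀ f, schToL2 d (Φ f) = U (schToL2 d f)

/-- The relation `ẑ Φ = Φ M ẑ`. -/
def Intertwines (ħ : ℝ) (M : Matrix (Fin d ⊕ Fin d) (Fin d ⊕ Fin d) ℝ)
    (Φ : Sch d ≃ₗ[ℂ] Sch d) : Prop :=
  ∀ k f, zhatSub ħ 0 0 k (Φ f) = Φ (∑ l, (M k l : ℂ) • zhatSub ħ 0 0 l f)

theorem zhatSub_zero_inl (ħ : ℝ) (k : Fin d) : zhatSub ħ 0 0 (Sum.inl k) = xhat k := by
  simp [zhatSub]

theorem zhatSub_zero_inr (ħ : ℝ) (k : Fin d) : zhatSub ħ 0 0 (Sum.inr k) = phat ħ k := by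
  simp [zhatSub]

theorem zhatSub_inl_apply (ħ : ℝ) (q p : Conf d) (k : Fin d) (f : Sch d) (x : Conf d) :
    zhatSub ħ q p (Sum.inl k) f x = xhat k f x - (q k : ℂ) * f x := rfl

theorem zhatSub_inr_apply (ħ : ℝ) (q p : Conf d) (k : Fin d) (f : Sch d) (x : Conf d) :
    zhatSub ħ q p (Sum.inr k) f x = phat ħ k f x - (p k : ℂ) * f x := rfl

theorem intertwines_fromBlocks_iff (ħ : ℝ) (A B C D : Matrix (Fin d) (Fin d) ℝ)
    (Φ : Sch d ≃ₗ[ℂ] Sch d) :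
    Intertwines ħ (Matrix.fromBlocks A B C D) Φ ↔
      (∀ k f, xhat k (Φ f)
        = Φ (∑ l, (A k l : ℂ) • xhat l f + ∑ l, (B k l : ℂ) • phat ħ l f)) ∧
      ∀ k f, phat ħ k (Φ f)
        = Φ (∑ l, (C k l : ℂ) • xhat l f + ∑ l, (D k l : ℂ) • phat ħ l f) := by
  simp [Intertwines, zhatSub_zero_inl, zhatSub_zero_inr]

theorem IsRestriction.one : IsRestriction (1 : U2 d) (LinearEquiv.refl ℂ (Sch d)) := fun _ => rfl

theorem IsRestriction.mul {U V : U2 d} {Φ Ψ : Sch d ≃ₗ[ℂ] Sch d} (hU : IsRestriction U Φ)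
    (hV : IsRestriction V Ψ) : IsRestriction (U * V) (Ψ.trans Φ) := fun f => by
  rw [LinearEquiv.trans_apply, hU, hV]; rfl

theorem IsRestriction.inv {U : U2 d} {Φ : Sch d ≃ₗ[ℂ] Sch d} (hU : IsRestriction U Φ) :
    IsRestriction U⁻¹ Φ.symm := fun f => by
  apply U.injective
  rw [← hU, LinearEquiv.apply_symm_apply]
  exact (U.apply_symm_apply _).symm

theorem Intertwines.one (ħ : ℝ) :
    Intertwines ħ (1 : Matrix (Fin d ⊕ Fin d) (Fin d ⊕ Fin d) ℝ) (LinearEquiv.refl ℂ _) := by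
  rw [← Matrix.fromBlocks_one, intertwines_fromBlocks_iff]
  simp [Matrix.one_apply]

/-- Matrices multiply in the same order as operators, because `Φ` is linear and lets the scalar
entries of the second matrix through. -/
theorem Intertwines.mul {ħ : ℝ} {M N : Matrix (Fin d ⊕ Fin d) (Fin d ⊕ Fin d) ℝ}
    {Φ Ψ : Sch d ≃ₗ[ℂ] Sch d} (hM : Intertwines ħ M Φ) (hN : Intertwines ħ N Ψ) :
    Intertwines ħ (M * N) (Ψ.trans Φ) := fun k f => by
  rw [LinearEquiv.trans_apply, LinearEquiv.trans_apply, hM]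
  congr 1
  simp only [hN _ f, ← map_smul Ψ, ← map_sum Ψ]
  congr 1
  simp only [Finset.smul_sum, smul_smul, Matrix.mul_apply, Complex.ofReal_sum,
    Complex.ofReal_mul, Finset.sum_smul]
  rw [Finset.sum_comm]

theorem Intertwines.symm {ħ : ℝ} {M N : Matrix (Fin d ⊕ Fin d) (Fin d ⊕ Fin d) ℝ}
    {Φ : Sch d ≃ₗ[ℂ] Sch d} (hM : Intertwines ħ M Φ) (hNM : N * M = 1) :
    Intertwines ħ N Φ.symm := fun k f => by
  obtain ⟨g, rfl⟩ := Φ.surjective f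
  simp only [hM _ g, ← map_smul Φ, ← map_sum Φ, LinearEquiv.symm_apply_apply]
  -- Reading the identity matrix as `N * M` expands `ẑ_k g` into the double sum needed.
  have h := Intertwines.one (d := d) ħ k g
  rw [← hNM] at h
  simp only [LinearEquiv.refl_apply, Matrix.mul_apply, Complex.ofReal_sum, Complex.ofReal_mul,
    Finset.sum_smul] at h
  simp only [h, Finset.smul_sum, smul_smul]
  rw [Finset.sum_comm]

/-! ### The generators -/

theorem isRestriction_affineUnitary (L : Matrix (Fin d) (Fin d) ℝ) (hL : L.det ≠ 0) (b : Conf d)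
    (u : Conf d → Circle) (hu : Continuous u) (hu' : (fun x => (u x : ℂ)).HasTemperateGrowth) :
    IsRestriction (affineUnitary L hL b u hu) (schAffine L hL b u hu') :=
  schToL2_schAffine L hL b u hu hu'

theorem hasLineDerivAt_circleExp {θ : Conf d → ℝ} {x v : Conf d} {θ' : ℝ}
    (hθ : HasLineDerivAt ℝ θ θ' x v) :
    HasLineDerivAt ℝ (fun x => (Circle.exp (θ x) : ℂ)) (I * θ' * Circle.exp (θ x)) x v := by
  have h := ((HasDerivAt.ofReal_comp hθ).mul_const I).cexp
  simp only [zero_smul, add_zero] at h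
  simp only [Circle.coe_exp]
  refine HasDerivAt.congr_deriv h ?_
  ring

/-- A constant phase commutes with everything, so only the dilation matters: `x = L⁻¹(L x)` for
positions, the chain rule for momenta. The lemma serves both `Mhat` and the dilation factor of
`Jhat`. -/
theorem intertwines_schAffine_const (ħ : ℝ) (hħ : ħ ≠ 0) (L : Matrix (Fin d) (Fin d) ℝ)
    (hL : L.det ≠ 0) (c : Circle) (hc : (fun _ : Conf d => (c : ℂ)).HasTemperateGrowth) :
    Intertwines ħ (Matrix.fromBlocks L⁻¹ 0 0 Lᵀ) (schAffine L hL 0 (fun _ => c) hc) := by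
  rw [intertwines_fromBlocks_iff]
  refine ⟨fun k f => ?_, fun k f => ?_⟩ <;> ext x
  · have hx : x k = ∑ l, L⁻¹ k l * affineMap L 0 x l := by
      have h : Matrix.toEuclideanCLM (𝕜 := ℝ) L⁻¹ (affineMap L 0 x) = x := by
        simpa [affineMap] using affineMap_inv_affineMap L hL 0 x
      conv_lhs => rw [← h]
      rw [Matrix.ofLp_toEuclideanCLM]; rfl
    rw [xhat_schAffine, schAffine_apply, affineFun, hx]
    simp [xhat_apply, Finset.sum_mul, mul_assoc]
  · have hg : HasLineDerivAt ℝ (fun _ : Conf d => (c : ℂ)) (I / ħ * 0 * c) x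
        (EuclideanSpace.single k 1) := by
      simpa [HasLineDerivAt] using hasDerivAt_const (0 : ℝ) (c : ℂ)
    rw [phat_schAffine ħ hħ L hL 0 _ hc k 0 x hg, schAffine_apply, affineFun]
    simp

theorem exists_intertwines_Mhat (ħ : ℝ) (hħ : ħ ≠ 0) (L : Matrix (Fin d) (Fin d) ℝ)
    (hL : L.det ≠ 0) (m : ℤ) :
    ∃ Φ, IsRestriction (Mhat L hL m) Φ ∧ Intertwines ħ (spM L hL : Matrix _ _ ℝ) Φ :=
  ⟨schAffine L hL 0 _ (.const _), isRestriction_affineUnitary L hL 0 _ continuous_const _,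
    intertwines_schAffine_const ħ hħ L hL _ _⟩

theorem exists_intertwines_Vhat (ħ : ℝ) (hħ : ħ ≠ 0) (R : Matrix (Fin d) (Fin d) ℝ)
    (hR : R.IsSymm) :
    ∃ Φ, IsRestriction (Vhat ħ R) Φ ∧ Intertwines ħ (spV R hR : Matrix _ _ ℝ) Φ := by
  have hθ : (fun x : Conf d => inner ℝ x (Matrix.toEuclideanCLM (𝕜 := ℝ) R x) / (2 * ħ)
      ).HasTemperateGrowth := by
    have h1 := (innerSL ℝ (E := Conf d)).bilinear_hasTemperateGrowth
      (Function.HasTemperateGrowth.id' (E := Conf d))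
      (Matrix.toEuclideanCLM (𝕜 := ℝ) R).hasTemperateGrowth
    simp only [div_eq_mul_inv]
    exact h1.mul (.const (2 * ħ)⁻¹)
  refine ⟨schAffine 1 (by simp) 0 _ (hasTemperateGrowth_circleExp hθ),
    isRestriction_affineUnitary _ _ _ _ _ _, ?_⟩
  rw [spV, intertwines_fromBlocks_iff]
  refine ⟨fun k f => ?_, fun k f => ?_⟩ <;> ext x
  · rw [xhat_schAffine, schAffine_apply, affineFun]
    simp [Matrix.one_apply, xhat_apply, affineMap]
  · have hd : HasLineDerivAt ℝ
        (fun x : Conf d => inner ℝ x (Matrix.toEuclideanCLM (𝕜 := ℝ) R x) / (2 * ħ))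
        ((∑ l, R k l * x l) / ħ) x (EuclideanSpace.single k 1) := by
      have h1 := (((hasFDerivAt_id x).inner ℝ
        (Matrix.toEuclideanCLM (𝕜 := ℝ) R).hasFDerivAt).mul_const (2 * ħ)⁻¹).hasLineDerivAt
          (EuclideanSpace.single k 1)
      simp only [div_eq_mul_inv]
      refine HasDerivAt.congr_deriv h1 ?_
      -- The product rule yields two terms; symmetry of `R` makes them equal, and their sum cancels
      -- the 2 in `2 * ħ`.
      have h2 : inner ℝ x (Matrix.toEuclideanCLM (𝕜 := ℝ) R (EuclideanSpace.single k 1))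
          = ∑ l, R k l * x l := by
        rw [toEuclideanCLM_single, inner_sum]
        refine Finset.sum_congr rfl fun l _ => ?_
        rw [real_inner_smul_right, EuclideanSpace.inner_single_right, hR.apply]
        simp
      have h3 : inner ℝ (EuclideanSpace.single k (1 : ℝ)) (Matrix.toEuclideanCLM (𝕜 := ℝ) R x)
          = ∑ l, R k l * x l := by
        rw [EuclideanSpace.inner_single_left, Matrix.ofLp_toEuclideanCLM]
        simp [Matrix.mulVec, dotProduct]
      change (2 * ħ)⁻¹ * (inner ℝ x (Matrix.toEuclideanCLM (𝕜 := ℝ) R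
        (EuclideanSpace.single k 1)) + inner ℝ (EuclideanSpace.single k (1 : ℝ))
          (Matrix.toEuclideanCLM (𝕜 := ℝ) R x)) = _
      rw [h2, h3]
      field_simp
      ring
    have hg := hasLineDerivAt_circleExp hd
    rw [phat_schAffine ħ hħ 1 (by simp) 0 _ _ k (∑ l, (R k l : ℂ) * x l) x
      (by convert hg using 1; push_cast; ring), schAffine_apply, affineFun]
    simp [Matrix.one_apply, xhat_apply, affineMap, Finset.sum_mul, mul_assoc, apply_ite ofReal]

/-! ### The Fourier transform exchanges position and momentum. -/

/-- The factor `2πħ` reflects the kernel `exp(-2πi x·y)`: a derivative becomes multiplication by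
`2πi x_k`, and `-iħ · 2πi = 2πħ`. -/
theorem xhat_fourier (ħ : ℝ) (hħ : ħ ≠ 0) (k : Fin d) (f : Sch d) :
    xhat k (𝓕 f) = 𝓕 (((2 * Real.pi * ħ)⁻¹ : ℂ) • phat ħ k f) := by
  have h := SchwartzMap.fourier_lineDerivOp_eq f (EuclideanSpace.single k (1 : ℝ))
  have hh : (ħ : ℂ) ≠ 0 := by exact_mod_cast hħ
  have hpi : (Real.pi : ℂ) ≠ 0 := by exact_mod_cast Real.pi_ne_zero
  have hp : phat ħ k f = (-(I * ħ)) • (∂_{EuclideanSpace.single k (1 : ℝ)} f) := rfl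
  rw [hp, smul_smul, FourierTransform.fourier_smul, h, smul_smul]
  ext x
  rw [xhat_apply, _root_.smul_apply, SchwartzMap.smulLeftCLM_apply_apply (by fun_prop)]
  simp only [EuclideanSpace.inner_single_right, Complex.real_smul, smul_eq_mul]
  field_simp
  simp [I_sq, mul_comm]

theorem phat_fourier (ħ : ℝ) (k : Fin d) (f : Sch d) :
    phat ħ k (𝓕 f) = 𝓕 (-(2 * Real.pi * ħ : ℂ) • xhat k f) := by
  have hp : phat ħ k (𝓕 f) = (-(I * ħ)) • (∂_{EuclideanSpace.single k (1 : ℝ)} (𝓕 f)) := rfl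
  rw [hp, SchwartzMap.lineDerivOp_fourier_eq, ← FourierTransform.fourier_smul, smul_smul]
  congr 1
  ext x
  rw [_root_.smul_apply, _root_.smul_apply, xhat_apply,
    SchwartzMap.smulLeftCLM_apply_apply (by fun_prop)]
  simp only [EuclideanSpace.inner_single_right, Complex.real_smul, smul_eq_mul]
  simp only [conj_trivial, one_mul]
  linear_combination (2 * Real.pi * ħ * (x k : ℂ) * f x) * I_sq

/-- With `c = 2πħ`, the dilation has matrix `diag(c, c⁻¹)` and the Fourier transform `[[0, c⁻¹],
[-c, 0]]`; their product is `J`. -/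
theorem exists_intertwines_Jhat (ħ : ℝ) (hħ : 0 < ħ) :
    ∃ Φ, IsRestriction (Jhat d ħ hħ) Φ ∧ Intertwines ħ (spJ d : Matrix _ _ ℝ) Φ := by
  set c : ℝ := 2 * Real.pi * ħ with hc
  have hc0 : c ≠ 0 := by positivity
  have hF : IsRestriction (Lp.fourierTransformₗᵢ (Conf d) ℂ)
      (FourierTransform.fourierEquiv ℂ (Sch d)) :=
    fun f => (SchwartzMap.toLp_fourier_eq f).symm
  have hD := intertwines_schAffine_const ħ hħ.ne' (c⁻¹ • (1 : Matrix (Fin d) (Fin d) ℝ))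
    (det_scalar_ne_zero d ħ hħ) (Circle.exp (-(Real.pi * d / 4))) (.const _)
  have hFi : Intertwines ħ (Matrix.fromBlocks 0 (c⁻¹ • 1) (-c • 1) 0)
      (FourierTransform.fourierEquiv ℂ (Sch d)) := by
    rw [intertwines_fromBlocks_iff]
    refine ⟨fun k f => ?_, fun k f => ?_⟩
    · rw [FourierTransform.fourierEquiv_apply, xhat_fourier ħ hħ.ne']
      simp [Matrix.one_apply, hc, -Complex.coe_smul, apply_ite ofReal]
    · rw [FourierTransform.fourierEquiv_apply, phat_fourier]
      simp [Matrix.one_apply, hc, -Complex.coe_smul, apply_ite ofReal]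
  refine ⟨_, (isRestriction_affineUnitary _ (det_scalar_ne_zero d ħ hħ) 0 _ continuous_const
    (.const _)).mul hF, ?_⟩
  convert hD.mul hFi using 1
  have hinv : (c⁻¹ • (1 : Matrix (Fin d) (Fin d) ℝ))⁻¹ = c • 1 :=
    Matrix.inv_eq_right_inv (by simp [smul_smul, hc0])
  rw [hinv, Matrix.fromBlocks_multiply]
  simp [spJ, matJ, smul_smul, hc0]

/-! ### Egorov relations for the metaplectic group and the Heisenberg–Weyl operator. -/

/-- Every metaplectic operator over `S` restricts to an automorphism `Φ` of the Schwartz space with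
`ẑ Φ = Φ S ẑ`. -/
theorem IsMetaplecticOver.exists_intertwines {ħ : ℝ} {hħ : 0 < ħ} {U : U2 d} {S : Sp d}
    (h : IsMetaplecticOver ħ hħ U S) :
    ∃ Φ, IsRestriction U Φ ∧ Intertwines ħ (S : Matrix _ _ ℝ) Φ := by
  -- Quantifying over pairs keeps operator and matrix coupled during the closure induction.
  suffices H : ∀ g ∈ metaplecticGraph d ħ hħ,
      ∃ Φ, IsRestriction g.1 Φ ∧ Intertwines ħ (g.2 : Matrix _ _ ℝ) Φ from H _ h
  intro g hg
  induction hg using Subgroup.closure_induction with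
  | mem g hg =>
    cases hg with
    | J => exact exists_intertwines_Jhat ħ hħ
    | V R hR => exact exists_intertwines_Vhat ħ hħ.ne' R hR
    | M L hL m hm => exact exists_intertwines_Mhat ħ hħ.ne' L hL m
  | one => exact ⟨_, IsRestriction.one, Intertwines.one ħ⟩
  | mul g g' _ _ hg hg' =>
    obtain ⟨Φ, hΦ, hΦ'⟩ := hg
    obtain ⟨Ψ, hΨ, hΨ'⟩ := hg'
    exact ⟨_, hΦ.mul hΨ, hΦ'.mul hΨ'⟩
  | inv g _ hg =>
    obtain ⟨Φ, hΦ, hΦ'⟩ := hg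
    refine ⟨_, hΦ.inv, hΦ'.symm ?_⟩
    exact congrArg Subtype.val (inv_mul_cancel g.2)

/-- The Heisenberg–Weyl operator restricts to an automorphism `Φ` of the Schwartz space with
`(ẑ - z) Φ = Φ ẑ`. -/
theorem exists_heisenbergWeyl_restriction (ħ : ℝ) (hħ : ħ ≠ 0) (q p : Conf d) :
    ∃ Φ, IsRestriction (heisenbergWeyl ħ q p) Φ ∧
      ∀ k f, zhatSub ħ q p k (Φ f) = Φ (zhatSub ħ 0 0 k f) := by
  have hθ : (fun x : Conf d => inner ℝ p (x - (1 / 2 : ℝ) • q) / ħ).HasTemperateGrowth := by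
    have h1 : (fun x : Conf d => inner ℝ p (x - (1 / 2 : ℝ) • q)).HasTemperateGrowth :=
      (innerSL ℝ p).hasTemperateGrowth.comp
        (Function.HasTemperateGrowth.id'.sub (.const ((1 / 2 : ℝ) • q)))
    simp only [div_eq_mul_inv]
    exact h1.mul (.const ħ⁻¹)
  refine ⟨schAffine 1 (by simp) (-q) _ (hasTemperateGrowth_circleExp hθ),
    isRestriction_affineUnitary _ _ _ _ _ _, ?_⟩
  rintro (k | k) f
  · rw [zhatSub_zero_inl]
    ext x
    rw [zhatSub_inl_apply, xhat_schAffine, schAffine_apply, schAffine_apply, affineFun, affineFun]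
    simp [xhat_apply, affineMap]
    ring
  · rw [zhatSub_zero_inr]
    ext x
    -- The shift by `q / 2` contributes only a constant phase and drops out of the derivative.
    have hd : HasLineDerivAt ℝ (fun x : Conf d => inner ℝ p (x - (1 / 2 : ℝ) • q) / ħ)
        (p k / ħ) x (EuclideanSpace.single k 1) := by
      have h1 := (((innerSL ℝ p).hasFDerivAt.comp x
        ((hasFDerivAt_id x).sub_const ((1 / 2 : ℝ) • q))).mul_const ħ⁻¹).hasLineDerivAt
          (EuclideanSpace.single k 1)
      simp only [div_eq_mul_inv]
      refine HasDerivAt.congr_deriv h1 ?_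
      simp [EuclideanSpace.inner_single_right, mul_comm]
    have hg := hasLineDerivAt_circleExp hd
    rw [zhatSub_inr_apply, phat_schAffine ħ hħ 1 (by simp) (-q) _ _ k (p k) x
      (by convert hg using 1; push_cast; ring), schAffine_apply,
      schAffine_apply, affineFun, affineFun]
    simp [Matrix.one_apply, affineMap, apply_ite ofReal]
    ring

end

end Hagedorn

namespace Hagedorn

noncomputable section

variable {d : ℕ}

/-! ### Ladder operators -/

theorem rho_apply (X : Matrix (Fin d ⊕ Fin d) (Fin d ⊕ Fin d) ℂ)
    (zh : Fin d ⊕ Fin d → (Sch d →ₗ[ℂ] Sch d)) (j : Fin d ⊕ Fin d) (f : Sch d) :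
    rho X zh j f = ∑ k, (Xᵀ * matJ d ℂ) j k • zh k f := by
  simp [rho]

/-- The real symplectic identity passes through the ring homomorphism `ℝ → ℂ`; the transpose stays a
plain transpose, without conjugation. -/
theorem transpose_map_ofReal_mul_matJ_mul (S : Sp d) :
    ((S : Matrix (Fin d ⊕ Fin d) (Fin d ⊕ Fin d) ℝ).map Complex.ofReal)ᵀ * matJ d ℂ
      * (S : Matrix (Fin d ⊕ Fin d) (Fin d ⊕ Fin d) ℝ).map Complex.ofReal = matJ d ℂ := by
  have h := congrArg (fun M => M.map Complex.ofRealHom) ((mem_Sp_iff _).mp S.2)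
  simp only [Matrix.map_mul, Matrix.transpose_map] at h
  have hJ : (matJ d ℝ).map Complex.ofRealHom = matJ d ℂ := by
    rw [matJ, matJ, Matrix.fromBlocks_map]
    congr 1 <;> ext i k <;> simp [Matrix.one_apply, apply_ite ofReal]
  rw [hJ] at h
  exact h

/-- If `(ẑ - z) Φ = Φ S ẑ` with `S` symplectic, then `ρ(S X; ẑ - z) Φ = Φ ρ(X; ẑ)`. -/
theorem rho_mul_apply (ħ : ℝ) (S : Sp d) (q p : Conf d) (Φ : Sch d ≃ₗ[ℂ] Sch d)
    (hΦ : ∀ k f, zhatSub ħ q p k (Φ f) = Φ (∑ l,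
      (((S : Matrix (Fin d ⊕ Fin d) (Fin d ⊕ Fin d) ℝ) k l : ℝ) : ℂ) • zhatSub ħ 0 0 l f))
    (X : Matrix (Fin d ⊕ Fin d) (Fin d ⊕ Fin d) ℂ) (j : Fin d ⊕ Fin d) (f : Sch d) :
    rho ((S : Matrix (Fin d ⊕ Fin d) (Fin d ⊕ Fin d) ℝ).map Complex.ofReal * X)
      (zhatSub ħ q p) j (Φ f) = Φ (rho X (zhatSub ħ 0 0) j f) := by
  set T := (S : Matrix (Fin d ⊕ Fin d) (Fin d ⊕ Fin d) ℝ).map Complex.ofReal with hT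
  -- Symplecticity enters here: `J` is replaced by `Tᵀ J T`, whose last factor is the matrix
  -- produced by commuting past `Φ`.
  have h : Xᵀ * matJ d ℂ = ((T * X)ᵀ * matJ d ℂ) * T := by
    rw [Matrix.transpose_mul, Matrix.mul_assoc, Matrix.mul_assoc, ← Matrix.mul_assoc Tᵀ,
      transpose_map_ofReal_mul_matJ_mul]
  rw [rho_apply, rho_apply, h]
  generalize (T * X)ᵀ * matJ d ℂ = Y
  simp only [hΦ, ← map_smul Φ, ← map_sum Φ]
  congr 1
  simp only [Matrix.mul_apply, Finset.smul_sum, smul_smul, Finset.sum_smul]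
  rw [Finset.sum_comm]
  rfl

/-! ### Passage from the Schwartz space to unbounded operators. -/

theorem toUnbounded_apply (A : Sch d →ₗ[ℂ] Sch d) (f : Sch d)
    (hf : schToL2 d f ∈ (toUnbounded A).domain) :
    toUnbounded A ⟨schToL2 d f, hf⟩ = schToL2 d (A f) := by
  have h : (LinearEquiv.ofInjective (schToL2 d) (schToL2_injective d)).symm ⟨schToL2 d f, hf⟩
      = f := by
    rw [LinearEquiv.symm_apply_eq]; rfl
  exact congrArg (fun g => schToL2 d (A g)) h

/-- The domains agree because `Φ` is onto: `U* x` is a Schwartz function exactly when `x` is. The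
values agree by writing each Schwartz function as `Φ g`. -/
theorem toUnbounded_eq_conjUnbounded {U : U2 d} {Φ : Sch d ≃ₗ[ℂ] Sch d} (hU : IsRestriction U Φ)
    {A B : Sch d →ₗ[ℂ] Sch d} (h : ∀ f, A (Φ f) = Φ (B f)) :
    toUnbounded A = conjUnbounded U (toUnbounded B) := by
  have hU' : ∀ f, U.symm (schToL2 d (Φ f)) = schToL2 d f := fun f => by
    rw [hU, U.symm_apply_apply]
  refine LinearPMap.ext ?_ ?_
  · ext x
    constructor
    · rintro ⟨f, rfl⟩
      obtain ⟨g, rfl⟩ := Φ.surjective f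
      exact ⟨g, (hU' g).symm⟩
    · rintro ⟨g, hg⟩
      refine ⟨Φ g, ?_⟩
      rw [hU, hg]
      exact U.apply_symm_apply x
  · rintro x ⟨f, rfl⟩ hg
    obtain ⟨g, rfl⟩ := Φ.surjective f
    refine (toUnbounded_apply A (Φ g) _).trans ?_
    rw [h, hU]
    change _ = U (toUnbounded B ⟨U.symm (schToL2 d (Φ g)), hg⟩)
    have hx : (⟨U.symm (schToL2 d (Φ g)), hg⟩ : (toUnbounded B).domain)
        = ⟨schToL2 d g, ⟨g, rfl⟩⟩ := Subtype.ext (hU' g)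
    rw [hx]
    exact congrArg U (toUnbounded_apply B g _).symm

/-! ### Adjoints -/

theorem inner_schToL2 (f g : Sch d) :
    inner ℂ (schToL2 d f) (schToL2 d g) = ∫ x, g x * (starRingEnd ℂ) (f x) :=
  SchwartzMap.inner_toL2_toL2_eq f g volume

theorem inner_xhat_left (k : Fin d) (f g : Sch d) :
    inner ℂ (schToL2 d (xhat k f)) (schToL2 d g)
      = inner ℂ (schToL2 d f) (schToL2 d (xhat k g)) := by
  rw [inner_schToL2, inner_schToL2]
  refine integral_congr_ae (Filter.Eventually.of_forall fun x => ?_)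
  simp only [xhat_apply, map_mul, conj_ofReal]
  ring

theorem inner_phat_left (ħ : ℝ) (k : Fin d) (f g : Sch d) :
    inner ℂ (schToL2 d (phat ħ k f)) (schToL2 d g)
      = inner ℂ (schToL2 d f) (schToL2 d (phat ħ k g)) := by
  have h : ∀ f : Sch d, schToL2 d (phat ħ k f)
      = (-(I * ħ)) • schToL2 d (∂_{EuclideanSpace.single k (1 : ℝ)} f) := fun f =>
    (schToL2 d).map_smul _ _
  -- Integration by parts for the pairing `(a, b) ↦ a * conj b`, which is bilinear over `ℝ` only.
  -- Its minus sign cancels the one from conjugating `-(I * ħ)`.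
  have hi := SchwartzMap.integral_bilinear_lineDerivOp_right_eq_neg_left (μ := volume) g f
    ((ContinuousLinearMap.mul ℝ ℂ).bilinearComp (.id ℝ ℂ) (conjCLE : ℂ →L[ℝ] ℂ))
    (EuclideanSpace.single k (1 : ℝ))
  simp only [ContinuousLinearMap.bilinearComp_apply, ContinuousLinearMap.mul_apply',
    ContinuousLinearMap.id_apply, ContinuousLinearEquiv.coe_coe, conjCLE_apply] at hi
  rw [h, h, inner_smul_left, inner_smul_right, inner_schToL2, inner_schToL2, hi]
  simp

theorem inner_aLower_left (ħ : ℝ) (j : Fin d) (f g : Sch d) :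
    inner ℂ (schToL2 d (aLower ħ j f)) (schToL2 d g)
      = inner ℂ (schToL2 d f) (schToL2 d (aRaise ħ j g)) := by
  simp only [aLower, aRaise, LinearMap.smul_apply, LinearMap.add_apply, LinearMap.sub_apply,
    map_smul, map_add, map_sub, inner_smul_left, inner_smul_right, inner_add_left,
    inner_sub_right, inner_xhat_left, inner_phat_left]
  simp only [map_div₀, map_one, conj_ofReal, conj_I]
  ring

theorem dense_range_schToL2 (d : ℕ) : Dense (LinearMap.range (schToL2 d) : Set (L2 d)) := by
  have h := SchwartzMap.denseRange_toLpCLM (E := Conf d) (F := ℂ) (p := 2) (μ := volume)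
    ENNReal.ofNat_ne_top
  exact h

theorem toUnbounded_le_adjoint {A B : Sch d →ₗ[ℂ] Sch d}
    (h : ∀ f g, inner ℂ (schToL2 d (A f)) (schToL2 d g)
      = inner ℂ (schToL2 d f) (schToL2 d (B g))) :
    toUnbounded B ≤ (toUnbounded A).adjoint := by
  -- Density of the Schwartz space is what makes the adjoint well defined.
  refine LinearPMap.IsFormalAdjoint.le_adjoint (dense_range_schToL2 d) ?_
  rintro ⟨_, f, rfl⟩ ⟨_, g, rfl⟩
  exact (congrArg (inner ℂ · _) (toUnbounded_apply A f _)).trans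
    ((h f g).trans (congrArg (inner ℂ _) (toUnbounded_apply B g _)).symm)

/-- On the Schwartz space `A` and `B` are conjugates of `A'` and `B'` by the restriction of a
unitary operator, so formal adjointness carries over. -/
theorem inner_conj_left {U : U2 d} {Φ : Sch d ≃ₗ[ℂ] Sch d} (hU : IsRestriction U Φ)
    {A B A' B' : Sch d →ₗ[ℂ] Sch d} (hA : ∀ f, A (Φ f) = Φ (A' f)) (hB : ∀ f, B (Φ f) = Φ (B' f))
    (h : ∀ f g, inner ℂ (schToL2 d (A' f)) (schToL2 d g)
      = inner ℂ (schToL2 d f) (schToL2 d (B' g))) (f g : Sch d) :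
    inner ℂ (schToL2 d (A f)) (schToL2 d g) = inner ℂ (schToL2 d f) (schToL2 d (B g)) := by
  obtain ⟨f, rfl⟩ := Φ.surjective f
  obtain ⟨g, rfl⟩ := Φ.surjective g
  rw [hA, hB, hU, hU, hU, hU, U.inner_map_map, U.inner_map_map, h]

/-! ### Explicit formulas -/

/-- The columns of `W_ħ` recombine real and imaginary parts: `S W_ħ` is `i / √(2ħ)` times `[[Q,
-Q̄], [P, -P̄]]`. Transposing turns the conjugates into `Q*` and `P*`, and `J` swaps the block
columns with one sign. -/
theorem transpose_mul_Wmat_mul_matJ (ħ : ℝ) (Q P : Matrix (Fin d) (Fin d) ℂ) :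
    ((Matrix.fromBlocks (Q.map Complex.re) (Q.map Complex.im) (P.map Complex.re)
      (P.map Complex.im)).map Complex.ofReal * Wmat d ħ)ᵀ * matJ d ℂ
      = (I / (Real.sqrt (2 * ħ) : ℂ)) • Matrix.fromBlocks (-Pᵀ) Qᵀ Pᴴ (-Qᴴ) := by
  have h1 : ∀ X : Matrix (Fin d) (Fin d) ℂ,
      I • (X.map Complex.re).map Complex.ofReal - (X.map Complex.im).map Complex.ofReal
        = I • X := fun X => by
    ext i k
    simp only [Matrix.sub_apply, Matrix.smul_apply, Matrix.map_apply, smul_eq_mul]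
    conv_rhs => rw [← Complex.re_add_im (X i k)]
    linear_combination -((X i k).im : ℂ) * I_sq
  -- `Xᴴᵀ` is the entrywise conjugate of `X`.
  have h2 : ∀ X : Matrix (Fin d) (Fin d) ℂ,
      -(I • (X.map Complex.re).map Complex.ofReal) - (X.map Complex.im).map Complex.ofReal
        = -(I • Xᴴᵀ) := fun X => by
    ext i k
    simp only [Matrix.sub_apply, Matrix.neg_apply, Matrix.smul_apply, Matrix.map_apply, smul_eq_mul,
      Matrix.transpose_apply, Matrix.conjTranspose_apply]
    conv_rhs => rw [← Complex.re_add_im (X i k)]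
    simp only [star_add, star_mul', Complex.star_def, conj_ofReal, conj_I]
    linear_combination -((X i k).im : ℂ) * I_sq
  rw [Wmat, matJ, Matrix.fromBlocks_map, Matrix.mul_smul, Matrix.fromBlocks_multiply]
  simp only [Matrix.mul_smul, Matrix.mul_neg, Matrix.mul_one, neg_smul, ← sub_eq_add_neg, h1, h2,
    Matrix.smul_mul, Matrix.transpose_smul, Matrix.fromBlocks_transpose,
    Matrix.fromBlocks_multiply, Matrix.transpose_neg, Matrix.transpose_transpose]
  simp only [div_eq_mul_inv, one_mul, Matrix.fromBlocks_smul, Matrix.mul_zero, add_zero,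
    zero_sub, smul_zero, neg_neg, smul_neg, smul_smul, mul_comm]

theorem rho_fromBlocks_Wmat (ħ : ℝ) (q p : Conf d) (Q P : Matrix (Fin d) (Fin d) ℂ) (j : Fin d) :
    rho ((Matrix.fromBlocks (Q.map Complex.re) (Q.map Complex.im) (P.map Complex.re)
      (P.map Complex.im)).map Complex.ofReal * Wmat d ħ) (zhatSub ħ q p) (Sum.inl j)
      = (-(I / (Real.sqrt (2 * ħ) : ℂ))) • ∑ k : Fin d,
        (Pᵀ j k • (xhat k - (q k : ℂ) • LinearMap.id)
          - Qᵀ j k • (phat ħ k - (p k : ℂ) • LinearMap.id)) ∧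
    rho ((Matrix.fromBlocks (Q.map Complex.re) (Q.map Complex.im) (P.map Complex.re)
      (P.map Complex.im)).map Complex.ofReal * Wmat d ħ) (zhatSub ħ q p) (Sum.inr j)
      = (I / (Real.sqrt (2 * ħ) : ℂ)) • ∑ k : Fin d,
        (Pᴴ j k • (xhat k - (q k : ℂ) • LinearMap.id)
          - Qᴴ j k • (phat ħ k - (p k : ℂ) • LinearMap.id)) := by
  constructor <;>
  · rw [rho, transpose_mul_Wmat_mul_matJ, Fintype.sum_sum_type, Finset.smul_sum,
      ← Finset.sum_add_distrib]
    refine Finset.sum_congr rfl fun k _ => ?_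
    simp only [zhatSub, Sum.elim_inl, Sum.elim_inr, Matrix.smul_apply, Matrix.fromBlocks_apply₁₁,
      Matrix.fromBlocks_apply₁₂, Matrix.fromBlocks_apply₂₁, Matrix.fromBlocks_apply₂₂,
      Matrix.neg_apply, smul_eq_mul]
    module

end

end Hagedorn

/-- Let `Ŝ` be a metaplectic operator over `S ∈ Sp(2d, ℝ)` and `z = (q, p)`.
(1) `𝒜_j(S,z) = T_z Ŝ â_j Ŝ* T_z*` and `𝒜*_j(S,z) = T_z Ŝ â*_j Ŝ* T_z*`, as unbounded operators
on `L²` with domain the Schwartz space. (2) `T_z Ŝ` restricts to an automorphism of the Schwartz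
space for which the two diagrams commute. (3) The explicit formulas in terms of `Q`, `P`.
(4) The raising operator is the restriction to the Schwartz space of the adjoint of the lowering
operator. -/
theorem mainTheorem9 (d : ℕ) (ħ : ℝ) (hħ : 0 < ħ) (S : Hagedorn.Sp d) (Shat : Hagedorn.U2 d)
    (hS : Hagedorn.IsMetaplecticOver ħ hħ Shat S) (q p : Hagedorn.Conf d) :
    (∀ j : Fin d,
      Hagedorn.toUnbounded (Hagedorn.hagLower ħ S q p j)
        = Hagedorn.conjUnbounded (Hagedorn.heisenbergWeyl ħ q p * Shat)
            (Hagedorn.toUnbounded (Hagedorn.aLower ħ j)) ∧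
      Hagedorn.toUnbounded (Hagedorn.hagRaise ħ S q p j)
        = Hagedorn.conjUnbounded (Hagedorn.heisenbergWeyl ħ q p * Shat)
            (Hagedorn.toUnbounded (Hagedorn.aRaise ħ j))) ∧
    (∃ Φ : Hagedorn.Sch d ≃ₗ[ℂ] Hagedorn.Sch d,
      (∀ f : Hagedorn.Sch d, Hagedorn.schToL2 d (Φ f)
        = Hagedorn.heisenbergWeyl ħ q p (Shat (Hagedorn.schToL2 d f))) ∧
      ∀ (j : Fin d) (f : Hagedorn.Sch d),
        Hagedorn.hagLower ħ S q p j (Φ f) = Φ (Hagedorn.aLower ħ j f) ∧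
        Hagedorn.hagRaise ħ S q p j (Φ f) = Φ (Hagedorn.aRaise ħ j f)) ∧
    (∀ Q P : Matrix (Fin d) (Fin d) ℂ,
      (S : Matrix (Fin d ⊕ Fin d) (Fin d ⊕ Fin d) ℝ)
        = Matrix.fromBlocks (Q.map Complex.re) (Q.map Complex.im)
            (P.map Complex.re) (P.map Complex.im) →
      ∀ j : Fin d,
        Hagedorn.hagLower ħ S q p j
          = (-(Complex.I / (Real.sqrt (2 * ħ) : ℂ))) •
            ∑ k : Fin d, (Pᵀ j k • (Hagedorn.xhat k - (q k : ℂ) • LinearMap.id)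
              - Qᵀ j k • (Hagedorn.phat ħ k - (p k : ℂ) • LinearMap.id)) ∧
        Hagedorn.hagRaise ħ S q p j
          = (Complex.I / (Real.sqrt (2 * ħ) : ℂ)) •
            ∑ k : Fin d, (Pᴴ j k • (Hagedorn.xhat k - (q k : ℂ) • LinearMap.id)
              - Qᴴ j k • (Hagedorn.phat ħ k - (p k : ℂ) • LinearMap.id))) ∧
    (∀ j : Fin d,
      Hagedorn.toUnbounded (Hagedorn.hagRaise ħ S q p j)
        ≤ (Hagedorn.toUnbounded (Hagedorn.hagLower ħ S q p j)).adjoint) := by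
  obtain ⟨Φ, hΦ, hΦz⟩ := hS.exists_intertwines
  obtain ⟨Ψ, hΨ, hΨz⟩ := Hagedorn.exists_heisenbergWeyl_restriction ħ hħ.ne' q p
  have hU := hΨ.mul hΦ
  -- The translation absorbs `z`, and the metaplectic factor then contributes `S`.
  have hz : ∀ k f, Hagedorn.zhatSub ħ q p k (Φ.trans Ψ f) = Φ.trans Ψ (∑ l,
      (((S : Matrix (Fin d ⊕ Fin d) (Fin d ⊕ Fin d) ℝ) k l : ℝ) : ℂ) •
        Hagedorn.zhatSub ħ 0 0 l f) := fun k f => by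
    rw [LinearEquiv.trans_apply, LinearEquiv.trans_apply, hΨz, hΦz]
  have hl : ∀ j f, Hagedorn.hagLower ħ S q p j (Φ.trans Ψ f)
      = Φ.trans Ψ (Hagedorn.aLower ħ j f) := fun j f => by
    rw [Hagedorn.hagLower, Hagedorn.rho_mul_apply ħ S q p _ hz, Hagedorn.rho_Wmat_inl]
  have hr : ∀ j f, Hagedorn.hagRaise ħ S q p j (Φ.trans Ψ f)
      = Φ.trans Ψ (Hagedorn.aRaise ħ j f) := fun j f => by
    rw [Hagedorn.hagRaise, Hagedorn.rho_mul_apply ħ S q p _ hz, Hagedorn.rho_Wmat_inr]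
  refine ⟨fun j => ⟨Hagedorn.toUnbounded_eq_conjUnbounded hU (hl j),
    Hagedorn.toUnbounded_eq_conjUnbounded hU (hr j)⟩,
    ⟨Φ.trans Ψ, hU, fun j f => ⟨hl j f, hr j f⟩⟩, fun Q P hQP j => ?_, fun j =>
    Hagedorn.toUnbounded_le_adjoint (Hagedorn.inner_conj_left hU (hl j) (hr j)
      (Hagedorn.inner_aLower_left ħ j))⟩
  rw [Hagedorn.hagLower, Hagedorn.hagRaise, hQP]
  exact Hagedorn.rho_fromBlocks_Wmat ħ q p Q P j
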